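/- **Setting.** Let $N\in\mathbb N$ and $Q=(-1/2,1/2)^N$. Matrices and tensors carry the Euclidean norm. For a distribution $T$ on $Q$ with values in $\mathbb R^m$ put $$|T|_{\mathcal M_b}:=\sup\{\langle T,\varphi\rangle:\ \varphi\in C_c^\infty(Q;\mathbb R^m),\ |\varphi|\le 1\}\in[0,\infty];$$ it is finite exactly if $T$ is a bounded Radon measure, and then it is the total variation of that measure. $BV(Q)$ is the set of $u\in L^1(Q)$ with $|Du|_{\mathcal M_b}<\infty$. We consider operators $\mathscr B v=\sum_{i=1}^N B^i\partial_i v$ with constant coefficients, $(\mathscr B v)_{lj}=\sum_{i,k=1}^N B^i_{ljk}\,\partial_i v_k$ for $v\in\mathcal D'(Q;\mathbb R^N)$, with norm $\|\mathscr B\|_{\ell^\infty}=\sum_i\|B^i\|$. Let $$BV_{\mathscr B}=\{v\in L^1(Q;\mathbb R^N): |\mathscr B v|_{\mathcal M_b}<\infty\},\qquad \|v\|_{BV_{\mathscr B}}=\|v\|_{L^1}+|\mathscr B v|_{\mathcal M_b}.$$ Let $\Pi$ be the set of those $\mathscr B$ that have a finite dimensional null space and for which 1. $BV_{\mathscr B}$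 is a Banach space; 2. for every $v\in BV_{\mathscr B}$ there are $v_n\in C^\infty(\overline Q;\mathbb R^N)$ with $v_n\to v$ in $L^1$ and $|\mathscr B v_n|_{\mathcal M_b}\to|\mathscr B v|_{\mathcal M_b}$; 3. the injection of $BV_{\mathscr B}$ into $L^1(Q;\mathbb R^N)$ is compact. A *training set* is a set $\Sigma\subset\Pi$ that is closed and bounded in $\|\cdot\|_{\ell^\infty}$ and such that, whenever $\mathscr B_n\in\Sigma$, $v_n\in BV_{\mathscr B_n}$ and $\sup_n(\|\mathscr B_n\|_{\ell^\infty}+\|v_n\|_{BV_{\mathscr B_n}})<\infty$, there are an operator $\mathscr B$ of the above form and $v\in BV_{\mathscr B}$ with, along a subsequence, $v_n\to v$ in $L^1$ and $\mathscr B_nv_n\to\mathscr B v$ weakly* as measures. For $\alpha=(\alpha_0,\alpha_1)$ with positive entries, $\mathscr B\in\Pi$ and $u\in L^1(Q)$ let $$PGV^2_{\alpha,\mathscr B}(u)=\inf\{\alpha_0|Du-v|_{\mathcal M_b}+\alpha_1|\mathscr B v|_{\mathcal M_b}:\ v\in BV_{\mathscr B}\}\in[0,\infty].$$ **Proposition.**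 Let $\Sigma$ be a training set, $\mathscr B\in\Sigma$, $u_\eta\in L^2(Q)$, and let $\alpha=(\alpha_0,\alpha_1)$ have positive entries. Then there is a unique $u_{\alpha,\mathscr B}\in BV(Q)$ such that $$\|u_{\alpha,\mathscr B}-u_\eta\|_{L^2(Q)}^2+PGV^2_{\alpha,\mathscr B}(u_{\alpha,\mathscr B})=\min\{\|u-u_\eta\|^2_{L^2(Q)}+PGV^2_{\alpha,\mathscr B}(u):\ u\in BV(Q)\},$$ where $\|u-u_\eta\|_{L^2(Q)}=\infty$ if $u\notin L^2(Q)$. -/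

import Mathlib

open MeasureTheory Filter Topology
open scoped ENNReal NNReal ContDiff Distributions

noncomputable section

namespace PGV

/-- The ambient Euclidean space `ℝ^N`. -/
abbrev Vec (N : ℕ) : Type := EuclideanSpace ℝ (Fin N)

/-- Real `N × N` matrices, with the Euclidean (Frobenius) norm. -/
abbrev Mat (N : ℕ) : Type := EuclideanSpace ℝ (Fin N × Fin N)

/-- The open unit cube `Q = (-1/2, 1/2)^N`. -/
def Q (N : ℕ) : TopologicalSpace.Opens (Vec N) where
  carrier := {x | ∀ i, x i ∈ Set.Ioo (-(1 / 2) : ℝ) (1 / 2)}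
  is_open' := by
    simp only [Set.ofPred_forall]
    exact isOpen_iInter_of_finite fun i =>
      isOpen_Ioo.preimage (EuclideanSpace.proj i : Vec N →L[ℝ] ℝ).continuous

/-- Lebesgue measure on `Q`. -/
abbrev μQ (N : ℕ) : Measure (Vec N) := volume.restrict (Q N : Set (Vec N))

/-- `L¹(Q)`. -/
abbrev L1 (N : ℕ) : Type := Lp ℝ 1 (μQ N)

/-- `L¹(Q; ℝ^N)`. -/
abbrev L1Vec (N : ℕ) : Type := Lp (Vec N) 1 (μQ N)

/-- First order homogeneous differential operators `𝓑 v = ∑ i, B^i ∂_i v` with constant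
coefficients, taking `ℝ^N`-valued to `ℝ^{N × N}`-valued distributions: such an operator is the
family `(B^i)_i` of third order tensors, and `B i (l, j, k)` is the entry `B^i_{ljk}`. The norm of
this type is `∑ i, ‖B^i‖`, with `‖B^i‖` the Euclidean norm. -/
abbrev DiffOp (N : ℕ) : Type :=
  PiLp 1 fun _ : Fin N => EuclideanSpace ℝ (Fin N × Fin N × Fin N)

/-- The partial derivative `∂_i φ` of a vector-valued function. -/
def pderiv {N : ℕ} {F : Type*} [NormedAddCommGroup F] [NormedSpace ℝ F]
    (i : Fin N) (φ : Vec N → F) (x : Vec N) : F :=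
  fderiv ℝ φ x (EuclideanSpace.single i 1)

/-- The norm in `𝓜_b(Q; F)` of a distribution `T`, acting on `F`-valued test functions in `Q`:
`|T| = sup {T(φ) : φ ∈ C_c^∞(Q; F), |φ| ≤ 1}`. It is finite exactly if `T` is a bounded Radon
measure, and then it is the total mass of the total variation measure of `T`. -/
def totalVar {N : ℕ} {F : Type*} [NormedAddCommGroup F] [NormedSpace ℝ F]
    (T : 𝓓(Q N, F) → ℝ) : ℝ≥0∞ :=
  ⨆ (φ : 𝓓(Q N, F)) (_ : ∀ x, ‖φ x‖ ≤ 1), ENNReal.ofReal (T φ)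

/-- The distributional gradient `Du` of `u ∈ L¹(Q)`: `⟨Du, φ⟩ = -∫_Q u div φ`. -/
def gradDistr {N : ℕ} (u : L1 N) (φ : 𝓓(Q N, Vec N)) : ℝ :=
  -∫ x, u x * ∑ i, pderiv i φ x i ∂μQ N

/-- The distribution given by `v ∈ L¹(Q; ℝ^N)`: `⟨v, φ⟩ = ∫_Q v · φ`. -/
def vecDistr {N : ℕ} (v : L1Vec N) (φ : 𝓓(Q N, Vec N)) : ℝ :=
  ∫ x, ∑ i, v x i * φ x i ∂μQ N

/-- The distribution `𝓑 v`, with entries `(𝓑 v)_{lj} = ∑_{i,k} B^i_{ljk} ∂_i v_k`: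
`⟨𝓑 v, φ⟩ = -∫_Q ∑_{l,j,i,k} B^i_{ljk} v_k ∂_i φ_{lj}`. -/
def opDistr {N : ℕ} (B : DiffOp N) (v : L1Vec N) (φ : 𝓓(Q N, Mat N)) : ℝ :=
  -∫ x, ∑ l, ∑ j, ∑ i, ∑ k, B i (l, j, k) * v x k * pderiv i φ x (l, j) ∂μQ N

/-- The space `BV(Q)` of functions in `L¹(Q)` whose gradient is a bounded Radon measure. -/
def BV (N : ℕ) : Set (L1 N) := {u | totalVar (gradDistr u) < ⊤}

/-- The space `BV_𝓑(Q; ℝ^N)` of all `v ∈ L¹(Q; ℝ^N)` for which `𝓑 v` is a bounded Radon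
measure. -/
def BVop {N : ℕ} (B : DiffOp N) : Set (L1Vec N) := {v | totalVar (opDistr B v) < ⊤}

/-- The norm `‖v‖_{L¹} + |𝓑 v|` of `BV_𝓑(Q; ℝ^N)`. -/
def bvNorm {N : ℕ} (B : DiffOp N) (v : L1Vec N) : ℝ≥0∞ := ‖v‖ₑ + totalVar (opDistr B v)

/-- `∂_i φ` is continuous and bounded, for a test function `φ`. -/
lemma continuous_pderiv {N : ℕ} {F : Type*} [NormedAddCommGroup F] [NormedSpace ℝ F]
    (i : Fin N) (φ : 𝓓(Q N, F)) : Continuous (pderiv i φ) :=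
  (φ.contDiff.continuous_fderiv (by simp)).clm_apply continuous_const

lemma bounded_pderiv {N : ℕ} {F : Type*} [NormedAddCommGroup F] [NormedSpace ℝ F]
    (i : Fin N) (φ : 𝓓(Q N, F)) : ∃ C, ∀ x, ‖pderiv i φ x‖ ≤ C :=
  (continuous_pderiv i φ).bounded_above_of_compact_support
    (φ.hasCompactSupport.fderiv_apply (𝕜 := ℝ) _)

lemma integrable_opDistr {N : ℕ} (B : DiffOp N) (v : L1Vec N) (φ : 𝓓(Q N, Mat N)) :
    Integrable (fun x => ∑ l, ∑ j, ∑ i, ∑ k, B i (l, j, k) * v x k * pderiv i φ x (l, j))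
      (μQ N) := by
  refine integrable_finsetSum _ fun l _ => integrable_finsetSum _ fun j _ =>
    integrable_finsetSum _ fun i _ => integrable_finsetSum _ fun k _ => ?_
  obtain ⟨C, hC⟩ := bounded_pderiv i φ
  have hv : Integrable (fun x => v x k) (μQ N) :=
    (EuclideanSpace.proj k : Vec N →L[ℝ] ℝ).integrable_comp
      (L1.integrable_coeFn v)
  refine (hv.const_mul (B i (l, j, k))).mul_bdd (c := C) ?_ ?_
  · exact ((EuclideanSpace.proj (l, j) : Mat N →L[ℝ] ℝ).continuous.comp
      (continuous_pderiv i φ)).aestronglyMeasurable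
  · exact ae_of_all _ fun x => (PiLp.norm_apply_le _ _).trans (hC x)

/-- The null space `{v : 𝓑 v = 0}` of `𝓑`. -/
def nullSpace {N : ℕ} (B : DiffOp N) : Submodule ℝ (L1Vec N) where
  carrier := {v | ∀ φ, opDistr B v φ = 0}
  zero_mem' := by
    intro φ
    have h : (fun x => ∑ l, ∑ j, ∑ i, ∑ k,
        B i (l, j, k) * (0 : L1Vec N) x k * pderiv i φ x (l, j)) =ᵐ[μQ N] fun _ => 0 := by
      filter_upwards [Lp.coeFn_zero (Vec N) 1 (μQ N)] with x hx
      simp only [hx, Pi.zero_apply, PiLp.zero_apply, mul_zero, zero_mul, Finset.sum_const_zero]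
    rw [opDistr, integral_congr_ae h, integral_zero, neg_zero]
  add_mem' := by
    intro v w hv hw φ
    have h : (fun x => ∑ l, ∑ j, ∑ i, ∑ k,
        B i (l, j, k) * (v + w) x k * pderiv i φ x (l, j)) =ᵐ[μQ N]
        fun x => (∑ l, ∑ j, ∑ i, ∑ k, B i (l, j, k) * v x k * pderiv i φ x (l, j)) +
          ∑ l, ∑ j, ∑ i, ∑ k, B i (l, j, k) * w x k * pderiv i φ x (l, j) := by
      filter_upwards [Lp.coeFn_add v w] with x hx
      simp only [hx, Pi.add_apply, PiLp.add_apply, mul_add, add_mul, Finset.sum_add_distrib]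
    have hv' := hv φ
    have hw' := hw φ
    simp only [opDistr] at hv' hw' ⊢
    rw [integral_congr_ae h,
      integral_add (integrable_opDistr B v φ) (integrable_opDistr B w φ)]
    linarith
  smul_mem' := by
    intro c v hv φ
    have h : (fun x => ∑ l, ∑ j, ∑ i, ∑ k,
        B i (l, j, k) * (c • v) x k * pderiv i φ x (l, j)) =ᵐ[μQ N]
        fun x => c * ∑ l, ∑ j, ∑ i, ∑ k, B i (l, j, k) * v x k * pderiv i φ x (l, j) := by
      filter_upwards [Lp.coeFn_smul c v] with x hx
      simp only [hx, Pi.smul_apply, PiLp.smul_apply, smul_eq_mul, Finset.mul_sum]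
      refine Finset.sum_congr rfl fun l _ => Finset.sum_congr rfl fun j _ =>
        Finset.sum_congr rfl fun i _ => Finset.sum_congr rfl fun k _ => by ring
    have hv' := hv φ
    simp only [opDistr] at hv' ⊢
    rw [integral_congr_ae h, integral_const_mul]
    simp only [neg_eq_zero] at hv' ⊢
    rw [hv', mul_zero]

/-- The standing assumptions on a single operator `𝓑`. -/
structure BasicAssumption {N : ℕ} (B : DiffOp N) : Prop where
  /-- `BV_𝓑(Q; ℝ^N)` is a Banach space: every Cauchy sequence for its norm converges. -/
  banach : ∀ v : ℕ → L1Vec N, (∀ n, v n ∈ BVop B) →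
    (∀ ε : ℝ≥0∞, 0 < ε → ∃ n₀, ∀ m ≥ n₀, ∀ n ≥ n₀, bvNorm B (v m - v n) ≤ ε) →
    ∃ w ∈ BVop B, Tendsto (fun n => bvNorm B (v n - w)) atTop (𝓝 0)
  /-- `C^∞` functions on the closed cube are dense in `BV_𝓑(Q; ℝ^N)` in the strict topology. -/
  strictDense : ∀ v ∈ BVop B, ∃ w : ℕ → L1Vec N,
    (∀ n, ∃ f : Vec N → Vec N, ContDiffOn ℝ ∞ f (closure (Q N : Set (Vec N))) ∧
      w n =ᵐ[μQ N] f) ∧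
    Tendsto w atTop (𝓝 v) ∧
    Tendsto (fun n => totalVar (opDistr B (w n))) atTop (𝓝 (totalVar (opDistr B v)))
  /-- Bounded subsets of `BV_𝓑(Q; ℝ^N)` are relatively compact in `L¹(Q; ℝ^N)`. -/
  compact : ∀ C : ℝ≥0, IsCompact (closure {v : L1Vec N | bvNorm B v ≤ C})

/-- The class `Π` of operators with a finite dimensional null space that satisfy the standing
assumptions. -/
def classPi (N : ℕ) : Set (DiffOp N) :=
  {B | FiniteDimensional ℝ (nullSpace B) ∧ BasicAssumption B}

/-- The joint compactness property of a collection `S` of operators: if `B_n ∈ S` and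
`‖B_n‖ + ‖v_n‖_{BV_{B_n}}` is bounded, then for some operator `𝓑` and some `w ∈ BV_𝓑(Q; ℝ^N)`,
along a subsequence, `v_n → w` in `L¹` and `𝓑_n v_n → 𝓑 w` weakly* as measures. Since `|𝓑_n v_n|`
is bounded and test functions are dense in `C_0(Q; ℝ^{N × N})`, the weak* convergence is
convergence against every test function. -/
def JointCompactness {N : ℕ} (S : Set (DiffOp N)) : Prop :=
  ∀ (v : ℕ → L1Vec N) (B : ℕ → DiffOp N), (∀ n, B n ∈ S) → (∀ n, v n ∈ BVop (B n)) →
    (∃ C : ℝ≥0, ∀ n, ‖B n‖ₑ + bvNorm (B n) (v n) ≤ C) →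
    ∃ (B' : DiffOp N), ∃ w ∈ BVop B', ∃ s : ℕ → ℕ, StrictMono s ∧
      Tendsto (fun n => v (s n)) atTop (𝓝 w) ∧
      ∀ φ : 𝓓(Q N, Mat N),
        Tendsto (fun n => opDistr (B (s n)) (v (s n)) φ) atTop (𝓝 (opDistr B' w φ))

/-- Training sets: closed and bounded subsets of `Π` with the joint compactness property. -/
structure IsTrainingSet {N : ℕ} (S : Set (DiffOp N)) : Prop where
  subset_classPi : S ⊆ classPi N
  jointCompactness : JointCompactness S
  closed : IsClosed S
  bounded : Bornology.IsBounded S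

/-- The seminorm
`PGV²_{α,𝓑}(u) = inf {α₀ |Du - v| + α₁ |𝓑 v| : v ∈ BV_𝓑(Q; ℝ^N)}`, with value `∞` allowed. -/
def pgv {N : ℕ} (α : Fin 2 → ℝ) (B : DiffOp N) (u : L1 N) : ℝ≥0∞ :=
  ⨅ v ∈ BVop B,
    ENNReal.ofReal (α 0) * totalVar (fun φ => gradDistr u φ - vecDistr v φ) +
    ENNReal.ofReal (α 1) * totalVar (opDistr B v)

/-- The functional `‖u - u_η‖²_{L²(Q)} + PGV²_{α,𝓑}(u)`; the first term is `∞` if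
`u` is not in `L²(Q)`. -/
def level2 {N : ℕ} (α : Fin 2 → ℝ) (B : DiffOp N) (uη : Lp ℝ 2 (μQ N)) (u : L1 N) : ℝ≥0∞ :=
  eLpNorm (fun x => u x - uη x) 2 (μQ N) ^ 2 + pgv α B u

end PGV

end

/-! The functional is infinite off `L²(Q)`, and `L²(Q)` embeds continuously in `L¹(Q)` because `Q`
is bounded, so the problem lives on a Hilbert space. There a squared distance plus a convex, lower
semicontinuous, proper term has exactly one minimizer: by the parallelogram law minimizing sequences
are Cauchy (`existsUnique_minimizer_enorm_sub_sq_add`). No compactness in `u` is needed.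

The substance is lower semicontinuity of `pgv` in `L¹` (`lowerSemicontinuous_pgv`). The energy of a
pair `(u, v)` is jointly lower semicontinuous, so it suffices that near-optimal `v` for a convergent
sequence of `u` subconverge in `L¹`. Compactness of `BV_𝓑` gives this once the `v` are bounded in
`L¹`, which follows by blow-up (`exists_enorm_le_of_energy_le`): normalized fields would converge to
some `w` of norm 1 with `energy α B 0 w = 0`, and this forces `w = 0`. -/

noncomputable section

namespace PGV

/-! ### Distributions as continuous functionals of `L¹` fields; total variation. -/

variable {N : ℕ}

lemma isBounded_Q : Bornology.IsBounded (Q N : Set (Vec N)) := by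
  have h : Bornology.IsBounded (Metric.closedBall (0 : Fin N → ℝ) 1) := Metric.isBounded_closedBall
  refine ((EuclideanSpace.equiv (Fin N) ℝ).symm.lipschitz.isBounded_image h).subset fun x hx => ?_
  refine ⟨fun i => x i, ?_, rfl⟩
  rw [mem_closedBall_zero_iff, pi_norm_le_iff_of_nonneg zero_le_one]
  intro i
  have hi := hx i
  rw [Real.norm_eq_abs, abs_le]
  constructor <;> linarith [hi.1, hi.2]

instance : IsFiniteMeasure (μQ N) := isFiniteMeasure_restrict.2 isBounded_Q.measure_lt_top.ne

/-- Integration against a continuous function on `Q` is a continuous linear functional on `L¹`. -/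
lemma exists_clm_eq_integral {E : Type*} [NormedAddCommGroup E] [NormedSpace ℝ E]
    (g : Vec N → E →L[ℝ] ℝ) (hg : Continuous g) :
    ∃ L : Lp E 1 (μQ N) →L[ℝ] ℝ, ∀ u, L u = ∫ x, g x (u x) ∂μQ N := by
  obtain ⟨C, hC⟩ := isBounded_Q.isCompact_closure.exists_bound_of_continuousOn
    (f := g) hg.continuousOn
  have hC' : ∀ᵐ x ∂μQ N, ‖g x‖ ≤ C := by
    filter_upwards [ae_restrict_mem (Q N).isOpen.measurableSet] with x hx
    exact hC x (subset_closure hx)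
  have hle (u : Lp E 1 (μQ N)) : ∀ᵐ x ∂μQ N, ‖g x (u x)‖ ≤ C * ‖u x‖ := by
    filter_upwards [hC'] with x hx
    exact (g x).le_of_opNorm_le hx _
  have hint (u : Lp E 1 (μQ N)) : Integrable (fun x => g x (u x)) (μQ N) := by
    refine ((L1.integrable_coeFn u).norm.const_mul C).mono' ?_ (hle u)
    exact isBoundedBilinearMap_apply.continuous.comp_aestronglyMeasurable₂
      hg.aestronglyMeasurable (L1.integrable_coeFn u).aestronglyMeasurable
  refine ⟨LinearMap.mkContinuous
    { toFun := fun u => ∫ x, g x (u x) ∂μQ N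
      map_add' := fun u v => ?_
      map_smul' := fun c u => ?_ } C fun u => ?_, fun u => rfl⟩
  · rw [← integral_add (hint u) (hint v)]
    refine integral_congr_ae ?_
    filter_upwards [Lp.coeFn_add u v] with x hx
    rw [hx, Pi.add_apply, map_add]
  · rw [RingHom.id_apply, smul_eq_mul, ← integral_const_mul]
    refine integral_congr_ae ?_
    filter_upwards [Lp.coeFn_smul c u] with x hx
    rw [hx, Pi.smul_apply, map_smul, smul_eq_mul]
  · refine (norm_integral_le_of_norm_le ((L1.integrable_coeFn u).norm.const_mul C) (hle u)).trans ?_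
    rw [integral_const_mul, L1.norm_eq_integral_norm]

lemma exists_clm_gradDistr (φ : 𝓓(Q N, Vec N)) :
    ∃ L : L1 N →L[ℝ] ℝ, ∀ u, gradDistr u φ = L u := by
  obtain ⟨L, hL⟩ := exists_clm_eq_integral
    (fun x => (∑ i, pderiv i φ x i) • ContinuousLinearMap.id ℝ ℝ)
    (by
      have := fun i => continuous_pderiv i φ
      fun_prop)
  refine ⟨-L, fun u => ?_⟩
  rw [neg_apply, hL, gradDistr]
  simp [mul_comm]

lemma exists_clm_vecDistr (φ : 𝓓(Q N, Vec N)) :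
    ∃ L : L1Vec N →L[ℝ] ℝ, ∀ v, vecDistr v φ = L v := by
  obtain ⟨L, hL⟩ := exists_clm_eq_integral
    (fun x => ∑ i, φ x i • (EuclideanSpace.proj i : Vec N →L[ℝ] ℝ)) (by fun_prop)
  refine ⟨L, fun u => ?_⟩
  rw [hL, vecDistr]
  simp [mul_comm]

lemma exists_clm_opDistr (B : DiffOp N) (φ : 𝓓(Q N, Mat N)) :
    ∃ L : L1Vec N →L[ℝ] ℝ, ∀ v, opDistr B v φ = L v := by
  obtain ⟨L, hL⟩ := exists_clm_eq_integral
    (fun x => ∑ l, ∑ j, ∑ i, ∑ k,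
      (B i (l, j, k) * pderiv i φ x (l, j)) • (EuclideanSpace.proj k : Vec N →L[ℝ] ℝ))
    (by
      have := fun i => continuous_pderiv i φ
      fun_prop)
  refine ⟨-L, fun u => ?_⟩
  rw [neg_apply, hL, opDistr]
  simp [mul_right_comm]

section totalVar

variable {F : Type*} [NormedAddCommGroup F] [NormedSpace ℝ F]

lemma ofReal_le_totalVar (T : 𝓓(Q N, F) → ℝ) (φ : 𝓓(Q N, F)) (hφ : ∀ x, ‖φ x‖ ≤ 1) :
    ENNReal.ofReal (T φ) ≤ totalVar T :=
  le_iSup₂ (f := fun (φ : 𝓓(Q N, F)) (_ : ∀ x, ‖φ x‖ ≤ 1) => ENNReal.ofReal (T φ)) φ hφ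

lemma totalVar_add_le (S T : 𝓓(Q N, F) → ℝ) :
    totalVar (fun φ => S φ + T φ) ≤ totalVar S + totalVar T :=
  iSup₂_le fun φ hφ => ENNReal.ofReal_add_le.trans
    (add_le_add (ofReal_le_totalVar S φ hφ) (ofReal_le_totalVar T φ hφ))

lemma totalVar_const_mul_le {c : ℝ} (hc : 0 ≤ c) (T : 𝓓(Q N, F) → ℝ) :
    totalVar (fun φ => c * T φ) ≤ ENNReal.ofReal c * totalVar T :=
  iSup₂_le fun φ hφ => by
    rw [ENNReal.ofReal_mul hc]
    exact mul_le_mul_right (ofReal_le_totalVar T φ hφ) _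

lemma lowerSemicontinuous_totalVar {X : Type*} [TopologicalSpace X] (T : X → 𝓓(Q N, F) → ℝ)
    (hT : ∀ φ, Continuous fun x => T x φ) : LowerSemicontinuous fun x => totalVar (T x) :=
  lowerSemicontinuous_iSup fun φ => lowerSemicontinuous_iSup fun _ =>
    (ENNReal.continuous_ofReal.comp (hT φ)).lowerSemicontinuous

/-- A homogeneous functional with vanishing total variation vanishes. -/
lemma eq_zero_of_totalVar_eq_zero (T : 𝓓(Q N, F) → ℝ)
    (hT : ∀ (c : ℝ) φ, T (c • φ) = c * T φ) (h : totalVar T = 0) (φ : 𝓓(Q N, F)) : T φ = 0 := by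
  obtain ⟨C, hC⟩ := φ.continuous.bounded_above_of_compact_support φ.hasCompactSupport
  have hC1 : 0 < |C| + 1 := by positivity
  -- Dividing by `|C| + 1`, positive for any bound `C`, makes `φ` admissible. Both signs are tested
  -- because `ENNReal.ofReal` discards negative values.
  have key (c : ℝ) (hc : |c| = 1) : c * T φ ≤ 0 := by
    have h1 : ENNReal.ofReal (T ((c * (|C| + 1)⁻¹) • φ)) ≤ 0 := by
      rw [← h]
      refine ofReal_le_totalVar T _ fun x => ?_
      rw [smul_apply, norm_smul, norm_mul, Real.norm_eq_abs c, hc, one_mul, norm_inv,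
        Real.norm_of_nonneg hC1.le, inv_mul_le_one₀ hC1]
      linarith [hC x, le_abs_self C]
    rw [nonpos_iff_eq_zero, ENNReal.ofReal_eq_zero, hT, mul_right_comm] at h1
    exact nonpos_of_mul_nonpos_left h1 (inv_pos.2 hC1)
  have h1 := key 1 (by simp)
  have h2 := key (-1) (by simp)
  linarith

end totalVar

lemma vecDistr_smul_right (v : L1Vec N) (c : ℝ) (φ : 𝓓(Q N, Vec N)) :
    vecDistr v (c • φ) = c * vecDistr v φ := by
  simp only [vecDistr, ← integral_const_mul, Finset.mul_sum, smul_apply, PiLp.smul_apply,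
    smul_eq_mul, mul_left_comm]

lemma totalVar_vecDistr_le (v : L1Vec N) : totalVar (vecDistr v) ≤ ‖v‖ₑ := by
  refine iSup₂_le fun φ hφ => ?_
  rw [← ofReal_norm, L1.norm_eq_integral_norm, vecDistr]
  refine ENNReal.ofReal_le_ofReal ((Real.le_norm_self _).trans
    (norm_integral_le_of_norm_le (L1.integrable_coeFn v).norm (ae_of_all _ fun x => ?_)))
  have h := norm_inner_le_norm (𝕜 := ℝ) (φ x) (v x)
  rw [PiLp.inner_apply] at h
  simp only [RCLike.inner_apply, conj_trivial] at h
  exact h.trans (mul_le_of_le_one_left (norm_nonneg _) (hφ x))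

/-- A vector field in `L¹` that vanishes as a distribution is zero. -/
lemma eq_zero_of_vecDistr_eq_zero (v : L1Vec N) (h : ∀ φ, vecDistr v φ = 0) : v = 0 := by
  have hk (k : Fin N) : ∀ᵐ x ∂μQ N, v x k = 0 := by
    have hv : Integrable (fun x => v x k) (μQ N) :=
      (EuclideanSpace.proj k : Vec N →L[ℝ] ℝ).integrable_comp (L1.integrable_coeFn v)
    have := (Q N).isOpen.ae_eq_zero_of_integral_contDiff_smul_eq_zero
      (hv.locallyIntegrable.locallyIntegrableOn _) fun g hg hgc hgs => ?_
    · filter_upwards [this, ae_restrict_mem (Q N).isOpen.measurableSet] with x hx hxQ using hx hxQ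
    · have hφ := h ⟨fun x => g x • EuclideanSpace.single k (1 : ℝ), hg.smul contDiff_const,
        hgc.smul_right, (tsupport_smul_subset_left _ _).trans hgs⟩
      simpa [vecDistr, mul_comm] using hφ
  rw [Lp.eq_zero_iff_ae_eq_zero]
  filter_upwards [ae_all_iff.2 hk] with x hx
  ext k
  exact hx k

end PGV
end

/-! ### Semicontinuity and convexity of the energy and of `PGV²`. -/

noncomputable section

/-- Allows the bound to vary along the sequence, as it does for approximate minimizers. -/
lemma LowerSemicontinuous.le_of_tendsto_of_le {X ι : Type*} [TopologicalSpace X]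
    {f : X → ℝ≥0∞} (hf : LowerSemicontinuous f) {l : Filter ι} [l.NeBot] {z : ι → X} {x : X}
    (hz : Tendsto z l (𝓝 x)) {c : ι → ℝ≥0∞} {C : ℝ≥0∞} (hc : Tendsto c l (𝓝 C))
    (hle : ∀ i, f (z i) ≤ c i) : f x ≤ C := by
  by_contra! h
  obtain ⟨y, hy1, hy2⟩ := exists_between h
  obtain ⟨i, hi1, hi2⟩ := ((hz.eventually (hf x y hy2)).and (hc.eventually_lt_const hy1)).exists
  exact (hi1.trans_le (hle i)).not_gt hi2

namespace PGV

variable {N : ℕ}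

/-- The functional `α₀ |Du - v| + α₁ |𝓑 v|` whose infimum over `v` is `PGV²_{α,𝓑}(u)`. -/
def energy (α : Fin 2 → ℝ) (B : DiffOp N) (u : L1 N) (v : L1Vec N) : ℝ≥0∞ :=
  ENNReal.ofReal (α 0) * totalVar (fun φ => gradDistr u φ - vecDistr v φ) +
    ENNReal.ofReal (α 1) * totalVar (opDistr B v)

lemma pgv_le_energy (α : Fin 2 → ℝ) (B : DiffOp N) (u : L1 N) {v : L1Vec N} (hv : v ∈ BVop B) :
    pgv α B u ≤ energy α B u v :=
  iInf₂_le v hv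

lemma exists_energy_lt {α : Fin 2 → ℝ} {B : DiffOp N} {u : L1 N} {c : ℝ≥0∞}
    (h : pgv α B u < c) : ∃ v ∈ BVop B, energy α B u v < c := by
  simpa only [pgv, energy, iInf_lt_iff, exists_prop] using h

lemma lowerSemicontinuous_energy (α : Fin 2 → ℝ) (B : DiffOp N) :
    LowerSemicontinuous fun p : L1 N × L1Vec N => energy α B p.1 p.2 := by
  have hmul (c : ℝ) : Continuous fun y : ℝ≥0∞ => ENNReal.ofReal c * y :=
    ENNReal.continuous_const_mul ENNReal.ofReal_ne_top
  refine LowerSemicontinuous.add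
    ((hmul (α 0)).comp_lowerSemicontinuous (lowerSemicontinuous_totalVar
      (fun (p : L1 N × L1Vec N) φ => gradDistr p.1 φ - vecDistr p.2 φ) fun φ => ?_)
      fun _ _ h => mul_le_mul_right h _)
    ((hmul (α 1)).comp_lowerSemicontinuous (lowerSemicontinuous_totalVar
      (fun (p : L1 N × L1Vec N) => opDistr B p.2) fun φ => ?_)
      fun _ _ h => mul_le_mul_right h _)
  · obtain ⟨L, hL⟩ := exists_clm_gradDistr φ
    obtain ⟨M, hM⟩ := exists_clm_vecDistr φ
    simp only [hL, hM]
    fun_prop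
  · obtain ⟨L, hL⟩ := exists_clm_opDistr B φ
    simp only [hL]
    fun_prop

/-- Joint sublinearity in the pair is what survives the infimum over `v` and makes `pgv` convex. -/
lemma energy_add_le (α : Fin 2 → ℝ) (B : DiffOp N) (u u' : L1 N) (v v' : L1Vec N) :
    energy α B (u + u') (v + v') ≤ energy α B u v + energy α B u' v' := by
  have h1 : (fun φ => gradDistr (u + u') φ - vecDistr (v + v') φ) =
      fun φ => (gradDistr u φ - vecDistr v φ) + (gradDistr u' φ - vecDistr v' φ) := by
    ext φ
    obtain ⟨L, hL⟩ := exists_clm_gradDistr φ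
    obtain ⟨M, hM⟩ := exists_clm_vecDistr φ
    simp only [hL, hM, map_add]
    ring
  have h2 : opDistr B (v + v') = fun φ => opDistr B v φ + opDistr B v' φ := by
    ext φ
    obtain ⟨L, hL⟩ := exists_clm_opDistr B φ
    simp only [hL, map_add]
  unfold energy
  rw [h1, h2, add_add_add_comm, ← mul_add, ← mul_add]
  gcongr <;> exact totalVar_add_le _ _

lemma energy_smul_le (α : Fin 2 → ℝ) (B : DiffOp N) {c : ℝ} (hc : 0 ≤ c) (u : L1 N)
    (v : L1Vec N) : energy α B (c • u) (c • v) ≤ ENNReal.ofReal c * energy α B u v := by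
  have h1 : (fun φ => gradDistr (c • u) φ - vecDistr (c • v) φ) =
      fun φ => c * (gradDistr u φ - vecDistr v φ) := by
    ext φ
    obtain ⟨L, hL⟩ := exists_clm_gradDistr φ
    obtain ⟨M, hM⟩ := exists_clm_vecDistr φ
    simp only [hL, hM, map_smul, smul_eq_mul]
    ring
  have h2 : opDistr B (c • v) = fun φ => c * opDistr B v φ := by
    ext φ
    obtain ⟨L, hL⟩ := exists_clm_opDistr B φ
    simp only [hL, map_smul, smul_eq_mul]
  unfold energy
  rw [h1, h2, mul_add, mul_left_comm, mul_left_comm (ENNReal.ofReal c)]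
  gcongr <;> exact totalVar_const_mul_le hc _

lemma energy_zero (α : Fin 2 → ℝ) (B : DiffOp N) : energy α B 0 0 = 0 := by
  simpa using energy_smul_le α B le_rfl 0 0

section

variable {α : Fin 2 → ℝ} (hα : ∀ i, 0 < α i) {B : DiffOp N}
include hα

lemma totalVar_opDistr_le (u : L1 N) (v : L1Vec N) :
    totalVar (opDistr B v) ≤ energy α B u v / ENNReal.ofReal (α 1) := by
  rw [ENNReal.le_div_iff_mul_le (by simp [hα 1]) (by simp), mul_comm]
  exact le_add_self

lemma totalVar_grad_sub_le (u : L1 N) (v : L1Vec N) :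
    totalVar (fun φ => gradDistr u φ - vecDistr v φ) ≤
      energy α B u v / ENNReal.ofReal (α 0) := by
  rw [ENNReal.le_div_iff_mul_le (by simp [hα 0]) (by simp), mul_comm]
  exact le_self_add

lemma mem_BVop_of_energy_lt_top {u : L1 N} {v : L1Vec N} (h : energy α B u v < ⊤) :
    v ∈ BVop B :=
  (totalVar_opDistr_le hα u v).trans_lt (ENNReal.div_lt_top h.ne (by simp [hα 1]))

lemma zero_mem_BVop : (0 : L1Vec N) ∈ BVop B :=
  mem_BVop_of_energy_lt_top hα (u := 0) (by rw [energy_zero]; exact ENNReal.zero_lt_top)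

lemma pgv_zero : pgv α B 0 = 0 :=
  nonpos_iff_eq_zero.1 ((pgv_le_energy α B 0 (zero_mem_BVop hα)).trans (energy_zero α B).le)

/-- Triangle inequality `|Du| ≤ |Du - v| + |v|`, where `|v|` is at most the `L¹` norm. -/
lemma mem_BV_of_pgv_lt_top {u : L1 N} (h : pgv α B u < ⊤) : u ∈ BV N := by
  obtain ⟨v, -, hv⟩ := exists_energy_lt h
  have h1 : totalVar (gradDistr u) ≤
      totalVar (fun φ => gradDistr u φ - vecDistr v φ) + totalVar (vecDistr v) := by
    simpa using totalVar_add_le (fun φ => gradDistr u φ - vecDistr v φ) (vecDistr v)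
  refine h1.trans_lt (ENNReal.add_lt_top.2 ⟨?_, (totalVar_vecDistr_le v).trans_lt enorm_lt_top⟩)
  exact (totalVar_grad_sub_le hα u v).trans_lt (ENNReal.div_lt_top hv.ne (by simp [hα 0]))

lemma eq_zero_of_energy_zero_left {v : L1Vec N} (h : energy α B 0 v = 0) : v = 0 := by
  have h0 : totalVar (fun φ => gradDistr (0 : L1 N) φ - vecDistr v φ) = 0 := by
    have := totalVar_grad_sub_le hα (B := B) 0 v
    rwa [h, ENNReal.zero_div, nonpos_iff_eq_zero] at this
  have hg (φ : 𝓓(Q N, Vec N)) : gradDistr (0 : L1 N) φ = 0 := by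
    obtain ⟨L, hL⟩ := exists_clm_gradDistr φ
    rw [hL, map_zero]
  simp only [hg, zero_sub] at h0
  refine eq_zero_of_vecDistr_eq_zero v fun φ => neg_eq_zero.1 <|
    eq_zero_of_totalVar_eq_zero (fun φ => -vecDistr v φ) (fun c φ => ?_) h0 φ
  rw [vecDistr_smul_right, mul_neg]

/-- Sequences that are bounded in `BV_𝓑` have subsequences that converge in `L¹`. -/
lemma exists_tendsto_subseq (hB : BasicAssumption B) {u : ℕ → L1 N} {v : ℕ → L1Vec N} {C R : ℝ≥0}
    (h : ∀ n, energy α B (u n) (v n) ≤ C) (hv : ∀ n, ‖v n‖ₑ ≤ R) :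
    ∃ w, ∃ s : ℕ → ℕ, StrictMono s ∧ Tendsto (v ∘ s) atTop (𝓝 w) := by
  have hlt : (R + C / ENNReal.ofReal (α 1) : ℝ≥0∞) < ⊤ :=
    ENNReal.add_lt_top.2 ⟨ENNReal.coe_lt_top, ENNReal.div_lt_top ENNReal.coe_ne_top (by simp [hα 1])⟩
  lift (R + C / ENNReal.ofReal (α 1) : ℝ≥0∞) to ℝ≥0 using hlt.ne with K hK
  obtain ⟨w, -, s, hs, hw⟩ := (hB.compact K).tendsto_subseq (x := v) fun n => subset_closure <| by
    rw [Set.mem_ofPred_eq, hK]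
    exact add_le_add (hv n)
      ((totalVar_opDistr_le hα (u n) (v n)).trans (ENNReal.div_le_div_right (h n) _))
  exact ⟨w, s, hs, hw⟩

/-- A bound on `α₀ |Du - v| + α₁ |𝓑 v|` and on `u` in `L¹` bounds `v` in `L¹`. -/
lemma exists_enorm_le_of_energy_le (hB : BasicAssumption B) {u : ℕ → L1 N} {v : ℕ → L1Vec N}
    {C : ℝ≥0} {K : ℝ} (hu : ∀ n, ‖u n‖ ≤ K) (h : ∀ n, energy α B (u n) (v n) ≤ C) :
    ∃ R : ℝ≥0, ∀ n, ‖v n‖ₑ ≤ R := by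
  by_contra! hcon
  have hex (n : ℕ) : ∃ m, (n + 1 : ℝ) < ‖v m‖ := by
    obtain ⟨m, hm⟩ := hcon (n + 1)
    refine ⟨m, ?_⟩
    rw [enorm_eq_nnnorm, ENNReal.coe_lt_coe] at hm
    exact_mod_cast hm
  choose s hs using hex
  have hpos (n : ℕ) : 0 < ‖v (s n)‖ := lt_trans (by positivity) (hs n)
  -- Blow-up scaling: `v (s n)` gets norm 1, while `u (s n)` and the energy, both bounded, are
  -- scaled to zero.
  set t : ℕ → ℝ := fun n => ‖v (s n)‖⁻¹ with ht
  have ht0 (n : ℕ) : 0 ≤ t n := (inv_pos.2 (hpos n)).le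
  have htle (n : ℕ) : t n ≤ 1 / (n + 1 : ℝ) := by
    rw [one_div]
    exact inv_anti₀ (by positivity) (hs n).le
  have htlim : Tendsto t atTop (𝓝 0) :=
    squeeze_zero ht0 htle tendsto_one_div_add_atTop_nhds_zero_nat
  have hE (n : ℕ) : energy α B (t n • u (s n)) (t n • v (s n)) ≤ ENNReal.ofReal (t n) * C :=
    (energy_smul_le α B (ht0 n) _ _).trans (mul_le_mul_right (h _) _)
  have hElim : Tendsto (fun n => ENNReal.ofReal (t n) * C) atTop (𝓝 0) := by
    simpa using ENNReal.Tendsto.mul_const (b := (C : ℝ≥0∞)) (ENNReal.tendsto_ofReal htlim)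
      (Or.inr ENNReal.coe_ne_top)
  have hnorm (n : ℕ) : ‖t n • v (s n)‖ = 1 := by
    rw [norm_smul, Real.norm_of_nonneg (ht0 n), ht, inv_mul_cancel₀ (hpos n).ne']
  obtain ⟨w, r, hr, hw⟩ := exists_tendsto_subseq hα hB (C := C) (R := 1)
    (u := fun n => t n • u (s n)) (v := fun n => t n • v (s n))
    (fun n => (hE n).trans (mul_le_of_le_one_left' (ENNReal.ofReal_le_one.2
      ((htle n).trans (by rw [div_le_one] <;> first | positivity | simp)))))
    (fun n => by rw [← ofReal_norm, hnorm]; simp)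
  have hulim : Tendsto (fun n => t n • u (s n)) atTop (𝓝 0) := by
    rw [tendsto_zero_iff_norm_tendsto_zero]
    refine squeeze_zero (fun n => norm_nonneg _) (g := fun n => t n * K) (fun n => ?_)
      (by simpa using htlim.mul_const K)
    rw [norm_smul, Real.norm_of_nonneg (ht0 n)]
    exact mul_le_mul_of_nonneg_left (hu _) (ht0 n)
  -- The limit pair `(0, w)` has zero energy by semicontinuity, although strong convergence
  -- preserves norm 1.
  have hw0 : w = 0 := by
    refine eq_zero_of_energy_zero_left hα (B := B) (nonpos_iff_eq_zero.1 ?_)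
    exact (lowerSemicontinuous_energy α B).le_of_tendsto_of_le (x := (0, w))
      ((hulim.comp hr.tendsto_atTop).prodMk_nhds hw) (hElim.comp hr.tendsto_atTop) fun n => hE (r n)
  have hw1 : ‖w‖ = 1 := tendsto_nhds_unique hw.norm (by simp [hnorm])
  simp [hw0] at hw1

lemma lowerSemicontinuous_pgv (hB : BasicAssumption B) :
    LowerSemicontinuous (pgv α B) := by
  refine lowerSemicontinuous_iff_isClosed_preimage.2 fun C =>
    IsSeqClosed.isClosed fun u x hu hx => ?_
  rcases eq_or_ne C ⊤ with rfl | hC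
  · exact (le_top : pgv α B x ≤ ⊤)
  lift C to ℝ≥0 using hC
  -- A vanishing slack replaces attainment of the infimum over `v`.
  have hlt (n : ℕ) : pgv α B (u n) < C + (n + 1 : ℝ≥0∞)⁻¹ :=
    lt_of_le_of_lt (hu n) (ENNReal.lt_add_right ENNReal.coe_ne_top
      (ENNReal.inv_ne_zero.2 (by finiteness)))
  choose v hvB hv using fun n => exists_energy_lt (hlt n)
  have hbd (n : ℕ) : energy α B (u n) (v n) ≤ (C + 1 : ℝ≥0) := by
    refine (hv n).le.trans ?_
    push_cast
    gcongr
    simp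
  obtain ⟨K, hK⟩ := hx.norm.bddAbove_range
  obtain ⟨R, hR⟩ := exists_enorm_le_of_energy_le hα hB (fun n => hK ⟨n, rfl⟩) hbd
  obtain ⟨w, s, hs, hw⟩ := exists_tendsto_subseq hα hB hbd hR
  have hlim : Tendsto (fun n : ℕ => C + (n + 1 : ℝ≥0∞)⁻¹) atTop (𝓝 C) := by
    have := ENNReal.tendsto_inv_nat_nhds_zero.comp (tendsto_add_atTop_nat 1)
    simpa [Function.comp_def] using this.const_add (C : ℝ≥0∞)
  have hE : energy α B x w ≤ C :=
    (lowerSemicontinuous_energy α B).le_of_tendsto_of_le (x := (x, w))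
      ((hx.comp hs.tendsto_atTop).prodMk_nhds hw) (hlim.comp hs.tendsto_atTop) fun n => (hv (s n)).le
  exact (pgv_le_energy α B x
    (mem_BVop_of_energy_lt_top hα (hE.trans_lt ENNReal.coe_lt_top))).trans hE

lemma pgv_add_le (x y : L1 N) : pgv α B (x + y) ≤ pgv α B x + pgv α B y := by
  rcases eq_or_ne (pgv α B x) ⊤ with hx | hx
  · simp [hx]
  rcases eq_or_ne (pgv α B y) ⊤ with hy | hy
  · simp [hy]
  refine ENNReal.le_of_forall_pos_le_add fun ε hε _ => ?_
  have hε2 : (ε / 2 : ℝ≥0∞) ≠ 0 := by simp [hε.ne']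
  obtain ⟨v, -, hv⟩ := exists_energy_lt (ENNReal.lt_add_right hx hε2)
  obtain ⟨w, -, hw⟩ := exists_energy_lt (ENNReal.lt_add_right hy hε2)
  have h := (energy_add_le α B x y v w).trans_lt (ENNReal.add_lt_add hv hw)
  refine (pgv_le_energy α B _ (mem_BVop_of_energy_lt_top hα h.lt_top)).trans (h.le.trans ?_)
  rw [add_add_add_comm, ENNReal.add_halves]

lemma pgv_smul_le {c : ℝ} (hc : 0 < c) (x : L1 N) :
    pgv α B (c • x) ≤ ENNReal.ofReal c * pgv α B x := by
  have hc0 : ENNReal.ofReal c ≠ 0 := by simpa using hc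
  refine le_of_forall_gt fun d hd => ?_
  rw [mul_comm, ← ENNReal.lt_div_iff_mul_lt (.inl hc0) (.inl ENNReal.ofReal_ne_top)] at hd
  obtain ⟨v, -, hv⟩ := exists_energy_lt hd
  rw [ENNReal.lt_div_iff_mul_lt (.inl hc0) (.inl ENNReal.ofReal_ne_top), mul_comm] at hv
  have h := (energy_smul_le α B hc.le x v).trans_lt hv
  exact (pgv_le_energy α B _ (mem_BVop_of_energy_lt_top hα h.lt_top)).trans_lt h

/-- `PGV²` is midpoint convex. -/
lemma pgv_midpoint_le (x y : L1 N) :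
    pgv α B ((1 / 2 : ℝ) • (x + y)) ≤ ENNReal.ofReal (1 / 2) * (pgv α B x + pgv α B y) :=
  (pgv_smul_le hα one_half_pos _).trans (mul_le_mul_right (pgv_add_le hα x y) _)

end

end PGV
end

/-! ### Minimization in a Hilbert space. -/

noncomputable section

section Hilbert

variable {H : Type*} [NormedAddCommGroup H] [InnerProductSpace ℝ H]

lemma enorm_midpoint_sub_sq (x y f : H) :
    ‖(1 / 2 : ℝ) • (x + y) - f‖ₑ ^ 2 + ENNReal.ofReal (1 / 4) * ‖x - y‖ₑ ^ 2 =
      ENNReal.ofReal (1 / 2) * (‖x - f‖ₑ ^ 2 + ‖y - f‖ₑ ^ 2) := by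
  have h := parallelogram_law_with_norm_mul ℝ (x - f) (y - f)
  have h1 : x - f + (y - f) = (2 : ℝ) • ((1 / 2 : ℝ) • (x + y) - f) := by module
  rw [h1, norm_smul, sub_sub_sub_cancel_right, Real.norm_ofNat] at h
  simp only [← ofReal_norm]
  rw [← ENNReal.ofReal_pow (norm_nonneg _), ← ENNReal.ofReal_pow (norm_nonneg _),
    ← ENNReal.ofReal_pow (norm_nonneg _), ← ENNReal.ofReal_pow (norm_nonneg _),
    ← ENNReal.ofReal_mul (by norm_num), ← ENNReal.ofReal_add (by positivity) (by positivity),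
    ← ENNReal.ofReal_add (by positivity) (by positivity), ← ENNReal.ofReal_mul (by norm_num)]
  congr 1
  linarith

/-- A midpoint convex, lower semicontinuous functional on a Hilbert space that is not identically
infinite has a unique minimizer after adding the squared distance to a point. -/
lemma existsUnique_minimizer_enorm_sub_sq_add [CompleteSpace H] {F : H → ℝ≥0∞}
    (hF : LowerSemicontinuous F)
    (hconv : ∀ x y, F ((1 / 2 : ℝ) • (x + y)) ≤ ENNReal.ofReal (1 / 2) * (F x + F y))
    (f : H) {x₀ : H} (hx₀ : F x₀ < ⊤) :
    ∃! x, ∀ y, ‖x - f‖ₑ ^ 2 + F x ≤ ‖y - f‖ₑ ^ 2 + F y := by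
  set J : H → ℝ≥0∞ := fun x => ‖x - f‖ₑ ^ 2 + F x with hJ
  set m := ⨅ x, J x with hm
  have hle (x : H) : m ≤ J x := iInf_le J x
  have hm_top : m ≠ ⊤ :=
    ((hle x₀).trans_lt (ENNReal.add_lt_top.2 ⟨ENNReal.pow_lt_top enorm_lt_top, hx₀⟩)).ne
  -- Near-minimizers are close: the midpoint still has value at least `m`, so the parallelogram gain
  -- `‖x - y‖² / 4` cannot exceed `ε`. This yields both the Cauchy property and, with `ε = 0`,
  -- uniqueness.
  have key {x y : H} {ε : ℝ} (hε : 0 ≤ ε) (hx : J x ≤ m + ENNReal.ofReal ε)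
      (hy : J y ≤ m + ENNReal.ofReal ε) : ‖x - y‖ ^ 2 ≤ 4 * ε := by
    have h2 : ENNReal.ofReal (1 / 2) + ENNReal.ofReal (1 / 2) = 1 := by
      rw [← ENNReal.ofReal_add (by norm_num) (by norm_num)]
      norm_num
    have h : m + ENNReal.ofReal (1 / 4) * ‖x - y‖ₑ ^ 2 ≤ m + ENNReal.ofReal ε := by
      calc m + ENNReal.ofReal (1 / 4) * ‖x - y‖ₑ ^ 2
          ≤ J ((1 / 2 : ℝ) • (x + y)) + ENNReal.ofReal (1 / 4) * ‖x - y‖ₑ ^ 2 := by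
            gcongr
            exact hle _
        _ = ENNReal.ofReal (1 / 2) * (‖x - f‖ₑ ^ 2 + ‖y - f‖ₑ ^ 2) +
              F ((1 / 2 : ℝ) • (x + y)) := by
            rw [← enorm_midpoint_sub_sq, hJ, add_right_comm]
        _ ≤ ENNReal.ofReal (1 / 2) * (‖x - f‖ₑ ^ 2 + ‖y - f‖ₑ ^ 2) +
              ENNReal.ofReal (1 / 2) * (F x + F y) := by
            gcongr
            exact hconv x y
        _ = ENNReal.ofReal (1 / 2) * (J x + J y) := by rw [hJ]; ring
        _ ≤ ENNReal.ofReal (1 / 2) * ((m + ENNReal.ofReal ε) + (m + ENNReal.ofReal ε)) := by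
            gcongr
        _ = m + ENNReal.ofReal ε := by rw [mul_add, ← add_mul, h2, one_mul]
    rw [ENNReal.add_le_add_iff_left hm_top, ← ofReal_norm, ← ENNReal.ofReal_pow (norm_nonneg _),
      ← ENNReal.ofReal_mul (by norm_num), ENNReal.ofReal_le_ofReal_iff hε] at h
    linarith
  have hex (n : ℕ) : ∃ x, J x < m + ENNReal.ofReal (1 / (n + 1 : ℝ)) := by
    refine iInf_lt_iff.1 (ENNReal.lt_add_right hm_top ?_)
    rw [ne_eq, ENNReal.ofReal_eq_zero, not_le]
    positivity
  choose x hx using hex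
  have hcauchy : CauchySeq x := by
    refine cauchySeq_of_le_tendsto_0 (fun n : ℕ => √(4 * (1 / (n + 1 : ℝ)))) (fun n k K hn hk => ?_)
      ?_
    · have hmono {n : ℕ} (hn : K ≤ n) : J (x n) ≤ m + ENNReal.ofReal (1 / (K + 1 : ℝ)) := by
        refine (hx n).le.trans ?_
        gcongr
      rw [dist_eq_norm]
      exact Real.le_sqrt_of_sq_le (key (by positivity) (hmono hn) (hmono hk))
    · simpa using (tendsto_one_div_add_atTop_nhds_zero_nat.const_mul (4 : ℝ)).sqrt
  obtain ⟨z, hz⟩ := cauchySeq_tendsto_of_complete hcauchy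
  have hJlsc : LowerSemicontinuous J := by
    refine LowerSemicontinuous.add (Continuous.lowerSemicontinuous ?_) hF
    fun_prop
  have hlim : Tendsto (fun n : ℕ => m + ENNReal.ofReal (1 / (n + 1 : ℝ))) atTop (𝓝 m) := by
    simpa using (ENNReal.tendsto_ofReal tendsto_one_div_add_atTop_nhds_zero_nat).const_add m
  have hJz : J z ≤ m := hJlsc.le_of_tendsto_of_le hz hlim fun n => (hx n).le
  refine ⟨z, fun y => hJz.trans (hle y), fun y hy => ?_⟩
  have h := key le_rfl (x := y) (y := z) (by simpa using (hy z).trans hJz) (by simpa using hJz)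
  rw [mul_zero, sq_nonpos_iff, norm_eq_zero, sub_eq_zero] at h
  exact h

end Hilbert

/-! ### Transfer between `L²(Q)` and `L¹(Q)`, and conclusion. -/

namespace PGV

variable {N : ℕ}

/-- The inclusion of `L²(Q)` in `L¹(Q)`. -/
def l2ToL1 (N : ℕ) : Lp ℝ 2 (μQ N) →+ L1 N :=
  AddSubgroup.inclusion (Lp.antitone one_le_two)

lemma coeFn_l2ToL1 (u : Lp ℝ 2 (μQ N)) : (l2ToL1 N u : Vec N → ℝ) = u := rfl

lemma l2ToL1_smul (c : ℝ) (u : Lp ℝ 2 (μQ N)) : l2ToL1 N (c • u) = c • l2ToL1 N u := rfl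

lemma continuous_l2ToL1 : Continuous (l2ToL1 N) := by
  -- The Hölder constant, i.e. the square root of the measure of `Q`.
  set K := (μQ N) Set.univ ^ (1 / (1 : ℝ≥0∞).toReal - 1 / (2 : ℝ≥0∞).toReal) with hK
  have hK' : K ≠ ⊤ := ENNReal.rpow_ne_top_of_nonneg (by norm_num) (measure_ne_top _ _)
  refine AddMonoidHomClass.continuous_of_bound (l2ToL1 N) K.toReal fun u => ?_
  rw [mul_comm, Lp.norm_def, Lp.norm_def, ← ENNReal.toReal_mul, coeFn_l2ToL1]
  exact ENNReal.toReal_mono (ENNReal.mul_ne_top (Lp.eLpNorm_ne_top u) hK')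
    (eLpNorm_le_eLpNorm_mul_rpow_measure_univ one_le_two (Lp.aestronglyMeasurable u))

lemma level2_l2ToL1 (α : Fin 2 → ℝ) (B : DiffOp N) (uη u : Lp ℝ 2 (μQ N)) :
    level2 α B uη (l2ToL1 N u) = ‖u - uη‖ₑ ^ 2 + pgv α B (l2ToL1 N u) := by
  rw [level2, coeFn_l2ToL1, Lp.enorm_def, eLpNorm_congr_ae (Lp.coeFn_sub u uη)]
  rfl

/-- Finiteness puts `u - uη` in `L²`, hence also `u = (u - uη) + uη`. -/
lemma exists_l2ToL1_eq {α : Fin 2 → ℝ} {B : DiffOp N} {uη : Lp ℝ 2 (μQ N)} {u : L1 N}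
    (h : level2 α B uη u < ⊤) : ∃ w, l2ToL1 N w = u := by
  have h1 : eLpNorm (fun x => u x - uη x) 2 (μQ N) < ⊤ := by
    simpa using (ENNReal.add_lt_top.1 h).1
  have h2 : MemLp (fun x => u x - uη x) 2 (μQ N) :=
    ⟨(Lp.aestronglyMeasurable u).sub (Lp.aestronglyMeasurable uη), h1⟩
  have h3 : MemLp u 2 (μQ N) :=
    (h2.add (Lp.memLp uη)).ae_eq (ae_of_all _ fun x => by simp)
  refine ⟨h3.toLp u, Lp.ext ?_⟩
  rw [coeFn_l2ToL1]
  exact h3.coeFn_toLp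

end PGV

end

theorem proposition5p1 {N : ℕ} (S : Set (PGV.DiffOp N)) (hS : PGV.IsTrainingSet S)
    (uη : MeasureTheory.Lp ℝ 2 (PGV.μQ N)) (B : PGV.DiffOp N) (hB : B ∈ S)
    (α : Fin 2 → ℝ) (hα : ∀ i, 0 < α i) :
    ∃! u : PGV.L1 N, u ∈ PGV.BV N ∧
      IsLeast (PGV.level2 α B uη '' PGV.BV N) (PGV.level2 α B uη u) := by
  have hBA := (hS.subset_classPi hB).2
  have h0 : PGV.pgv α B (PGV.l2ToL1 N 0) < ⊤ := by
    rw [map_zero, PGV.pgv_zero hα]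
    exact ENNReal.zero_lt_top
  obtain ⟨z, hz, huniq⟩ := existsUnique_minimizer_enorm_sub_sq_add
    (F := fun w => PGV.pgv α B (PGV.l2ToL1 N w))
    ((PGV.lowerSemicontinuous_pgv hα hBA).comp PGV.continuous_l2ToL1)
    (fun x y => by
      rw [PGV.l2ToL1_smul, map_add]
      exact PGV.pgv_midpoint_le hα _ _) uη h0
  simp only [← PGV.level2_l2ToL1] at hz huniq
  have hfin : PGV.level2 α B uη (PGV.l2ToL1 N z) < ⊤ := by
    refine (hz 0).trans_lt ?_
    rw [PGV.level2_l2ToL1]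
    exact ENNReal.add_lt_top.2 ⟨ENNReal.pow_lt_top enorm_lt_top, h0⟩
  have hzBV := PGV.mem_BV_of_pgv_lt_top hα (ENNReal.add_lt_top.1 hfin).2
  refine ⟨PGV.l2ToL1 N z, ⟨hzBV, ⟨_, hzBV, rfl⟩, ?_⟩, ?_⟩
  · rintro _ ⟨u, -, rfl⟩
    rcases eq_or_ne (PGV.level2 α B uη u) ⊤ with hu | hu
    · exact hu ▸ le_top
    · obtain ⟨w, rfl⟩ := PGV.exists_l2ToL1_eq hu.lt_top
      exact hz w
  · rintro u ⟨-, -, hu⟩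
    -- A minimizer over `BV` does at least as well as `z`, which is optimal over all of `L²`; so
    -- Hilbert space uniqueness applies to it.
    have hle : PGV.level2 α B uη u ≤ PGV.level2 α B uη (PGV.l2ToL1 N z) := hu ⟨_, hzBV, rfl⟩
    obtain ⟨w, rfl⟩ := PGV.exists_l2ToL1_eq (hle.trans_lt hfin)
    rw [huniq w fun y => hle.trans (hz y)]
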